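/- Let $k\ge 2$ be an integer and let $G$ be a finite simple undirected graph. Call $G$ *$k$-edge-connected* if deleting fewer than $k$ edges from $G$ always leaves any two vertices connected, and *minimally $k$-edge-connected* if $G$ is $k$-edge-connected but $G\setminus e$ is not $k$-edge-connected for any edge $e$ of $G$. An edge-coloring $\Gamma$ of $G$ (adjacent edges may receive the same color) is an *$MC_k$-coloring* if every two distinct vertices $u,v$ of $G$ are connected by at least $k$ pairwise edge-disjoint $uv$-paths each of which is monochromatic, i.e. all its edges have the same color (different paths may have different colors). Let $mc_k(G)$ denote the maximum number of colors used by an $MC_k$-coloring of $G$. If $G$ is minimally $k$-edge-connected, then $mc_k(G)\le k-1$. -/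

import Mathlib

namespace SimpleGraph

variable {V : Type*} {K : Type*}

/-- `G` is minimally `k`-edge-connected: it is `k`-edge-connected, and deleting any one of its
edges destroys this property (no edge is deletable). -/
def IsMinimallyEdgeConnected (G : SimpleGraph V) (k : ℕ) : Prop :=
  G.IsEdgeConnected k ∧ ∀ e ∈ G.edgeSet, ¬ (G.deleteEdges {e}).IsEdgeConnected k

/-- A walk is monochromatic for an edge-colouring `Γ` if all its edges have the same colour. -/
def Walk.IsMonochromatic {G : SimpleGraph V} (Γ : G.EdgeLabeling K) {u v : V}
    (p : G.Walk u v) : Prop :=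
  ∃ c : K, ∀ (e : Sym2 V) (he : e ∈ p.edges), Γ ⟨e, p.edges_subset_edgeSet he⟩ = c

/-- `Γ` is an `MC_k`-colouring of `G`: every two distinct vertices are connected by at least `k`
pairwise edge-disjoint monochromatic paths (different paths may have different colours). -/
def IsMCColoring {G : SimpleGraph V} (k : ℕ) (Γ : G.EdgeLabeling K) : Prop :=
  ∀ u v : V, u ≠ v → ∃ P : Fin k → G.Path u v,
    (∀ i, (P i : G.Walk u v).IsMonochromatic Γ) ∧
    ∀ i j, i ≠ j → List.Disjoint (P i : G.Walk u v).edges (P j : G.Walk u v).edges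

/-- The numbers `r` such that some `MC_k`-colouring of `G` uses exactly `r` colours. -/
def mcColorCounts (G : SimpleGraph V) (k : ℕ) : Set ℕ :=
  {r | ∃ Γ : G.EdgeLabeling (Fin r), Function.Surjective Γ ∧ IsMCColoring k Γ}

/-- The monochromatic `k`-edge-connection number `mc_k(G)`: the maximum number of colours used
by an `MC_k`-colouring of `G`. -/
noncomputable def mcNumber (G : SimpleGraph V) (k : ℕ) : ℕ :=
  sSup (G.mcColorCounts k)

/-- For a finite graph the set of colour counts is bounded by the number of edges. -/
theorem bddAbove_mcColorCounts [Finite V] (G : SimpleGraph V) (k : ℕ) :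
    BddAbove (G.mcColorCounts k) := by
  refine ⟨Nat.card G.edgeSet, ?_⟩
  rintro r ⟨Γ, hΓ, -⟩
  simpa using Nat.card_le_card_of_surjective Γ hΓ

/-- So `mc_k(G)` is a genuine maximum as soon as `G` has an `MC_k`-colouring at all. -/
theorem isGreatest_mcNumber [Finite V] (G : SimpleGraph V) (k : ℕ)
    (h : (G.mcColorCounts k).Nonempty) : IsGreatest (G.mcColorCounts k) (G.mcNumber k) :=
  ⟨Nat.sSup_mem h (G.bddAbove_mcColorCounts k), fun _ hr =>
    le_csSup (G.bddAbove_mcColorCounts k) hr⟩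

end SimpleGraph

namespace SimpleGraph

/-! By minimality every edge `e` lies in a cut of at most `k` edges. The `k` disjoint paths across
it use up all its edges, so the path through `e` has colour `Γ e`; hence each colour class is
connected and spanning. With `k` or more colours, such a cut contains each colour exactly once, so
it is determined by any one of its edges. An edge `xy` of another colour closes a cycle with a path
of colour `c`, of length at least two as `G` is simple. Two edges of that path give cuts that both
contain `xy`, hence coincide, yet hold two edges of colour `c`. -/

/-- The edges of `G` with exactly one end in `X`. -/
def edgeCut {V : Type*} (G : SimpleGraph V) (X : Set V) : Set G.edgeSet :=
  {e | ∃ a ∈ X, ∃ b ∉ X, e.1 = s(a, b)}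

theorem mk_mem_edgeCut {V : Type*} {G : SimpleGraph V} {X : Set V} {a b : V} (h : G.Adj a b) :
    (⟨s(a, b), h⟩ : G.edgeSet) ∈ G.edgeCut X ↔ ¬(a ∈ X ↔ b ∈ X) := by
  simp only [edgeCut, Set.mem_ofPred_eq, Sym2.eq_iff]
  constructor
  · rintro ⟨c, hc, d, hd, ⟨rfl, rfl⟩ | ⟨rfl, rfl⟩⟩ <;> tauto
  · intro h
    by_cases ha : a ∈ X
    · exact ⟨a, ha, b, by tauto, by simp⟩
    · exact ⟨b, by tauto, a, ha, by simp⟩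

/-- Every edge of a minimally `k`-edge-connected graph lies in a cut of at most `k` edges. -/
theorem IsMinimallyEdgeConnected.exists_mem_edgeCut {V : Type*} [Finite V] {G : SimpleGraph V}
    {k : ℕ} (hG : G.IsMinimallyEdgeConnected k) (e : G.edgeSet) :
    ∃ X : Set V, e ∈ G.edgeCut X ∧ (G.edgeCut X).ncard ≤ k := by
  obtain ⟨hconn, hmin⟩ := hG
  have h := hmin e.1 e.2
  simp only [IsEdgeConnected, IsEdgeReachable, not_forall] at h
  obtain ⟨u, v, s, hs, hnr⟩ := h
  set H := (G.deleteEdges {e.1}).deleteEdges s with hH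
  have hcut : ∀ f ∈ G.edgeCut {w | H.Reachable u w}, f.1 = e.1 ∨ f.1 ∈ s := by
    rintro ⟨f, hf⟩ ⟨a, ha, b, hb, rfl⟩
    by_contra! hcon
    refine hb (ha.trans (Adj.reachable ?_))
    simpa [hH, deleteEdges_adj, hcon] using hf
  refine ⟨{w | H.Reachable u w}, ?_, ?_⟩
  -- Fewer than `k` edges are in `s`, so deleting `s` alone leaves a walk from `u` to `v`; it can
  -- only leave the component of `u` in `H` through `e`.
  · by_contra he
    obtain ⟨p⟩ := hconn u v hs
    obtain ⟨d, -, hd1, hd2⟩ := p.exists_boundary_dart {w | H.Reachable u w} (Reachable.refl u) hnr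
    have hadj := d.adj
    rw [deleteEdges_adj] at hadj
    have hmem : (⟨s(d.fst, d.snd), hadj.1⟩ : G.edgeSet) ∈ G.edgeCut {w | H.Reachable u w} :=
      ⟨_, hd1, _, hd2, rfl⟩
    rcases hcut _ hmem with h | h
    · exact he (Subtype.ext h ▸ hmem)
    · exact hadj.2 h
  · have hsub : Subtype.val '' G.edgeCut {w | H.Reachable u w} ⊆ insert e.1 s := by
      rintro _ ⟨f, hf, rfl⟩
      exact hcut f hf
    rw [← Set.ncard_image_of_injective _ Subtype.val_injective]
    refine (Set.ncard_le_ncard hsub).trans ((Set.ncard_insert_le _ _).trans ?_)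
    rw [← s.toFinite.cast_ncard_eq] at hs
    exact_mod_cast hs

/-- A colour occurring in a cut of at most `k` edges joins any two vertices separated by the cut. -/
theorem IsMCColoring.reachable_labelGraph_of_mem_edgeCut {V K : Type*} [Finite V]
    {G : SimpleGraph V} {k : ℕ} {Γ : G.EdgeLabeling K} (hΓ : IsMCColoring k Γ) {X : Set V}
    (hX : (G.edgeCut X).ncard ≤ k) {e : G.edgeSet} (he : e ∈ G.edgeCut X) {u v : V}
    (hu : u ∈ X) (hv : v ∉ X) : (Γ.labelGraph (Γ e)).Reachable u v := by
  obtain ⟨P, hmono, hdisj⟩ := hΓ u v (fun h => hv (h ▸ hu))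
  have hex : ∀ i, ∃ f ∈ G.edgeCut X, f.1 ∈ (P i : G.Walk u v).edges := fun i => by
    obtain ⟨d, hd, h1, h2⟩ := (P i : G.Walk u v).exists_boundary_dart X hu hv
    exact ⟨⟨d.edge, d.edge_mem⟩, ⟨_, h1, _, h2, rfl⟩, List.mem_map_of_mem hd⟩
  choose f hf hfP using hex
  have hinj : Function.Injective f := fun i j hij => by
    by_contra hne
    exact hdisj i j hne (hfP i) (hij ▸ hfP j)
  -- `k` distinct edges exhaust a cut of at most `k`.
  have hrange : Set.range f = G.edgeCut X := by
    refine Set.eq_of_subset_of_ncard_le (Set.range_subset_iff.2 hf) (hX.trans ?_)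
    rw [← Set.image_univ, Set.ncard_image_of_injective _ hinj]
    simp
  obtain ⟨i, rfl⟩ := hrange ▸ he
  obtain ⟨c, hc⟩ := hmono i
  have hfc : Γ (f i) = c := hc _ (hfP i)
  refine ⟨(P i : G.Walk u v).transfer _ fun e he => ?_⟩
  have heG := (P i : G.Walk u v).edges_subset_edgeSet he
  have hec := hc e he
  induction e with | _ a b
  exact (EdgeLabeling.labelGraph_adj a b).2 ⟨heG, hec.trans hfc.symm⟩

/-- In a minimally `k`-edge-connected graph, every colour of an `MC_k`-colouring induces a connected
spanning subgraph. -/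
theorem IsMCColoring.preconnected_labelGraph {V K : Type*} [Finite V]
    {G : SimpleGraph V} {k : ℕ} (hG : G.IsMinimallyEdgeConnected k) {Γ : G.EdgeLabeling K}
    (hΓ : IsMCColoring k Γ) (e : G.edgeSet) : (Γ.labelGraph (Γ e)).Preconnected := by
  obtain ⟨X, he, hX⟩ := hG.exists_mem_edgeCut e
  have key : ∀ {u v : V}, u ∈ X → v ∉ X → (Γ.labelGraph (Γ e)).Reachable u v :=
    hΓ.reachable_labelGraph_of_mem_edgeCut hX he
  obtain ⟨a, ha, b, hb, -⟩ := he
  intro u v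
  have h : ∀ w, (Γ.labelGraph (Γ e)).Reachable a w := fun w => by
    by_cases hw : w ∈ X
    · exact (key ha hb).trans (key hw hb).symm
    · exact key ha hw
  exact (h u).symm.trans (h v)

/-- If each of at least `k` colours induces a connected spanning subgraph, then a cut of at most `k`
edges, separating some two vertices, contains no two edges of the same colour. -/
theorem EdgeLabeling.injOn_edgeCut {V : Type*} [Finite V] {G : SimpleGraph V} {k r : ℕ}
    (hr : k ≤ r) {Γ : G.EdgeLabeling (Fin r)} (hΓ : ∀ c, (Γ.labelGraph c).Preconnected) {X : Set V}
    (hne : (G.edgeCut X).Nonempty) (hX : (G.edgeCut X).ncard ≤ k) :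
    Set.InjOn Γ (G.edgeCut X) := by
  obtain ⟨-, a, ha, b, hb, -⟩ := hne
  have himage : Γ '' G.edgeCut X = Set.univ := by
    refine Set.eq_univ_of_forall fun c => ?_
    obtain ⟨p⟩ := hΓ c a b
    obtain ⟨d, -, h1, h2⟩ := p.exists_boundary_dart X ha hb
    obtain ⟨hadj, hc⟩ := (EdgeLabeling.labelGraph_adj _ _).1 d.adj
    exact ⟨⟨_, hadj⟩, ⟨_, h1, _, h2, rfl⟩, hc⟩
  refine Set.injOn_of_ncard_image_eq (le_antisymm (Set.ncard_image_le) ?_)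
  rw [himage, Set.ncard_univ, Nat.card_fin]
  exact hX.trans hr

/-- A monochromatic walk avoiding the only edge of its colour in a cut stays on one side. -/
theorem EdgeLabeling.mem_iff_of_notMem_edges {V K : Type*} {G : SimpleGraph V}
    {Γ : G.EdgeLabeling K} {X : Set V} (hinj : Set.InjOn Γ (G.edgeCut X)) {e : G.edgeSet}
    (he : e ∈ G.edgeCut X) {u v : V} (p : (Γ.labelGraph (Γ e)).Walk u v) (hp : e.1 ∉ p.edges) :
    u ∈ X ↔ v ∈ X := by
  induction p with
  | nil => rfl
  | @cons a b c hab q ih =>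
    rw [Walk.edges_cons, List.mem_cons, not_or] at hp
    refine Iff.trans ?_ (ih hp.2)
    obtain ⟨hadj, hc⟩ := (EdgeLabeling.labelGraph_adj _ _).1 hab
    by_contra hne
    exact hp.1 (congrArg Subtype.val (hinj ((mk_mem_edgeCut hadj).2 hne) he hc)).symm

/-- Two cuts in which a common edge is the only one of its colour agree, if that colour induces a
connected spanning subgraph. -/
theorem EdgeLabeling.edgeCut_subset_of_mem {V K : Type*} {G : SimpleGraph V}
    {Γ : G.EdgeLabeling K} {X Y : Set V} (hX : Set.InjOn Γ (G.edgeCut X))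
    (hY : Set.InjOn Γ (G.edgeCut Y)) {f : G.edgeSet} (hfX : f ∈ G.edgeCut X)
    (hfY : f ∈ G.edgeCut Y) (hΓ : (Γ.labelGraph (Γ f)).Preconnected) :
    G.edgeCut X ⊆ G.edgeCut Y := by
  have hadj : ∀ a b, (Γ.labelGraph (Γ f)).Adj a b → ((a ∈ X ↔ a ∈ Y) ↔ (b ∈ X ↔ b ∈ Y)) := by
    intro a b hab
    obtain ⟨h, hc⟩ := (EdgeLabeling.labelGraph_adj _ _).1 hab
    have : (⟨s(a, b), h⟩ : G.edgeSet) ∈ G.edgeCut X ↔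
        (⟨s(a, b), h⟩ : G.edgeSet) ∈ G.edgeCut Y :=
      ⟨fun h' => hX h' hfX hc ▸ hfY, fun h' => hY h' hfY hc ▸ hfX⟩
    rw [mk_mem_edgeCut, mk_mem_edgeCut] at this
    tauto
  -- So `Y` is `X` or its complement.
  have hall : ∀ a b, ((a ∈ X ↔ a ∈ Y) ↔ (b ∈ X ↔ b ∈ Y)) := fun a b => by
    obtain ⟨p⟩ := hΓ a b
    induction p with
    | nil => rfl
    | cons h _ ih => exact (hadj _ _ h).trans ih
  rintro ⟨e, he⟩ hcut
  induction e with | _ a b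
  rw [mk_mem_edgeCut he] at hcut ⊢
  have := hall a b
  tauto

/-- An `MC_k`-colouring of a minimally `k`-edge-connected graph, `2 ≤ k`, uses fewer than `k`
colours. -/
theorem IsMCColoring.card_lt {V : Type*} [Finite V] {G : SimpleGraph V} {k r : ℕ} (hk : 2 ≤ k)
    (hG : G.IsMinimallyEdgeConnected k) {Γ : G.EdgeLabeling (Fin r)}
    (hsurj : Function.Surjective Γ) (hΓ : IsMCColoring k Γ) : r < k := by
  classical
  by_contra! hr
  have hconn : ∀ c, (Γ.labelGraph c).Preconnected := fun c => by
    obtain ⟨e, rfl⟩ := hsurj c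
    exact hΓ.preconnected_labelGraph hG e
  have hcut : ∀ e : G.edgeSet, ∃ X : Set V, e ∈ G.edgeCut X ∧ Set.InjOn Γ (G.edgeCut X) :=
    fun e => by
      obtain ⟨X, he, hX⟩ := hG.exists_mem_edgeCut e
      exact ⟨X, he, EdgeLabeling.injOn_edgeCut hr hconn ⟨e, he⟩ hX⟩
  let c : Fin r := ⟨0, by omega⟩
  obtain ⟨⟨f, hf⟩, hfc⟩ := hsurj ⟨1, by omega⟩
  have hfc' : Γ ⟨f, hf⟩ ≠ c := by simp [hfc, c]
  induction f with | _ x y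
  -- In colour `c`, the ends of the edge `xy` are joined by a path of length at least two.
  obtain ⟨p, hp⟩ := (hconn c x y).exists_isPath
  cases p with
  | nil => exact G.irrefl hf
  | @cons _ z _ hxz q =>
  rw [Walk.cons_isPath_iff] at hp
  obtain ⟨hq, hxq⟩ := hp
  cases q with
  | nil => exact hfc' ((EdgeLabeling.labelGraph_adj _ _).1 hxz).2
  | @cons _ w _ hzw q =>
  have hzq := ((Walk.cons_isPath_iff _ _).1 hq).2
  obtain ⟨hG₁, hc₁⟩ := (EdgeLabeling.labelGraph_adj _ _).1 hxz
  obtain ⟨hG₂, hc₂⟩ := (EdgeLabeling.labelGraph_adj _ _).1 hzw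
  obtain ⟨X, heX, hX⟩ := hcut ⟨s(x, z), hG₁⟩
  obtain ⟨Y, heY, hY⟩ := hcut ⟨s(z, w), hG₂⟩
  have hne : s(x, z) ≠ s(z, w) := fun h => by
    refine hxq ((Walk.cons hzw q).fst_mem_support_of_mem_edges (t := x) (u := z) ?_)
    simp [h]
  -- Each of the first two edges of this path determines a cut containing `xy`.
  have hfX : (⟨s(x, y), hf⟩ : G.edgeSet) ∈ G.edgeCut X := by
    have h := EdgeLabeling.mem_iff_of_notMem_edges hX heX
      ((Walk.cons hzw q).mapLe (by rw [hc₁])) (by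
        rw [Walk.edges_mapLe_eq_edges]
        exact fun h => hxq (Walk.fst_mem_support_of_mem_edges _ h))
    rw [mk_mem_edgeCut] at heX
    refine (mk_mem_edgeCut hf).2 ?_
    tauto
  have hfY : (⟨s(x, y), hf⟩ : G.edgeSet) ∈ G.edgeCut Y := by
    have h := EdgeLabeling.mem_iff_of_notMem_edges hY heY (q.mapLe (by rw [hc₂])) (by
        rw [Walk.edges_mapLe_eq_edges]
        exact fun h => hzq (Walk.fst_mem_support_of_mem_edges _ h))
    -- The edge `zw` is the only one of colour `c` in the cut of `Y`.
    have h' : x ∈ Y ↔ z ∈ Y := by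
      by_contra hcon
      exact hne (congrArg Subtype.val
        (hY ((mk_mem_edgeCut hG₁).2 hcon) heY (hc₁.trans hc₂.symm)))
    rw [mk_mem_edgeCut] at heY
    refine (mk_mem_edgeCut hf).2 ?_
    tauto
  have hsub := EdgeLabeling.edgeCut_subset_of_mem hX hY hfX hfY (hconn _)
  exact hne (congrArg Subtype.val (hY (hsub heX) heY (hc₁.trans hc₂.symm)))

end SimpleGraph

theorem theorem2p5 {V : Type*} [Finite V] (G : SimpleGraph V) (k : ℕ) (hk : 2 ≤ k)
    (hG : G.IsMinimallyEdgeConnected k) : G.mcNumber k ≤ k - 1 := by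
  -- If no colouring exists, the supremum is `0`.
  refine csSup_le' ?_
  rintro r ⟨Γ, hsurj, hΓ⟩
  exact Nat.le_sub_one_of_lt (hΓ.card_lt hk hG hsurj)
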